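/- For a real matrix $M$ let $\|M\|_*$ be its trace norm, i.e. the sum of its singular values, let $\mathrm{Diag}(w)$ be the diagonal matrix with diagonal $w\in\mathbb R^p$, and let $\mathbb S_p$ be the space of real symmetric $p\times p$ matrices. Fix $p\ge 0$ and $w\in\mathbb R^p$ (entries may be zero or negative). Then, as $\Delta\to 0$ in $\mathbb S_p$ (with $\|\Delta\|$ the Frobenius norm; the choice of norm is immaterial), $$\|(I+\Delta)\mathrm{Diag}(w)\|_* = \sum_i |w_i| + \sum_i \Delta_{ii}|w_i| + \sum_{|w_i|>0}\sum_{|w_j|>0}\frac{(\Delta_{ji}|w_i|-\Delta_{ij}|w_j|)^2}{4(|w_i|+|w_j|)} + \sum_{|w_i|=0}\sum_{|w_j|>0}\frac{(\Delta_{ij}|w_j|)^2}{2|w_j|} + o(\|\Delta\|^2),$$ and equivalently $$\|(I+\Delta)\mathrm{Diag}(w)\|_* = \sum_i |w_i| + \sum_i \Delta_{ii}|w_i| + \sum_{i,j} f_{\Delta_{ij}}(|w_i|,|w_j|) + o(\|\Delta\|^2),$$ where $f_d(a,b)=\dfrac{d^2(a-b)^2}{4(a+b)}$ for $a,b\ge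 0$ not both zero, and $f_d(0,0)=0$. The second-order term shrinks coefficients of correlated pairs toward each other, in the following sense: whenever $\Delta_{ij}\neq 0$, one has $f_{\Delta_{ij}}(|w_i|,|w_j|)\ge 0$, with equality if and only if $|w_i|=|w_j|$; and if $a,b$ both lie in the closed interval with end points $|w_i|$ and $|w_j|$ and $|a-b|<\big||w_i|-|w_j|\big|$, then $f_{\Delta_{ij}}(a,b)<f_{\Delta_{ij}}(|w_i|,|w_j|)$. -/

import Mathlib

open Filter Topology Asymptotics
open scoped Matrix.Norms.Frobenius

namespace TraceLasso

/-- The trace norm (nuclear norm) of a real matrix: the sum of its singular values.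
The singular values of the linear map `ℝⁿ → ℝᵐ` (Euclidean norms) with matrix `A` are listed with
multiplicity by the indices `0, …, n - 1`. -/
noncomputable def traceNorm {m n : Type*} [Fintype m] [Fintype n] [DecidableEq n]
    (A : Matrix m n ℝ) : ℝ :=
  ∑ k ∈ Finset.range (Fintype.card n), (Matrix.toEuclideanLin A).singularValues k

/-- The contribution `d² (a - b)² / (4 (a + b))` of a pair of coefficients with absolute values
`a, b ≥ 0` and correlation perturbation `d`, understood as `0` when `a = b = 0`. -/
noncomputable def pairPenalty (d a b : ℝ) : ℝ :=
  if a = 0 ∧ b = 0 then 0 else d ^ 2 * (a - b) ^ 2 / (4 * (a + b))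

end TraceLasso

/-! The trace norm of `A` is the trace of the positive semidefinite root of `Aᵀ * A`, so the
expansion is second-order perturbation theory for a square root. With `D = diag |w|`, conjugation by
the signs of `w` turns the Gram matrix into `D (1 + Δ)² D`. This is singular where `w` vanishes;
adding the projection onto those coordinates makes the unperturbed root positive definite and adds a
constant to the trace (`exists_posSemidef_sq_eq`). Two Sylvester equations then give an approximate
root `X` whose square is correct up to `o(‖Δ‖²)` (`sqrt_approx_mul_self`), and `abs_trace_sub_le`
bounds the error in the trace by the error in the square. It remains to compute the trace of `X`. -/

namespace TraceLasso

open Matrix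

/-! ### Trace norm as the trace of a square root, and stability of roots. -/

section Sqrt

variable {m n : Type*} [Fintype m] [Fintype n] [DecidableEq n]

/-- The trace norm is the trace of the positive semidefinite square root of `Aᵀ A`. -/
theorem exists_posSemidef_sq_eq_transpose_mul_self [DecidableEq m] (A : Matrix m n ℝ) :
    ∃ Y : Matrix n n ℝ, Y.PosSemidef ∧ Y * Y = Aᵀ * A ∧ Y.trace = traceNorm A := by
  have hA : (Aᴴ * A).IsHermitian := isHermitian_conjTranspose_mul_self A
  have hpos : (Aᴴ * A).PosSemidef := posSemidef_conjTranspose_mul_self A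
  have hsv (k : Fin (Fintype.card n)) :
      (Matrix.toEuclideanLin A).singularValues k = √(hA.eigenvalues₀ k) := by
    have hT : (Matrix.toEuclideanLin A).adjoint ∘ₗ Matrix.toEuclideanLin A
        = Matrix.toEuclideanLin (Aᴴ * A) := by
      rw [← Matrix.toEuclideanLin_conjTranspose_eq_adjoint]
      refine LinearMap.ext fun v => ?_
      simp [toLpLin_apply]
    have hev {T T' : EuclideanSpace ℝ n →ₗ[ℝ] EuclideanSpace ℝ n} (h : T = T')
        (h₁ : T.IsSymmetric) (h₂ : T'.IsSymmetric) :
        h₁.eigenvalues finrank_euclideanSpace k = h₂.eigenvalues finrank_euclideanSpace k := by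
      subst h; rfl
    exact ((Matrix.toEuclideanLin A).singularValues_fin finrank_euclideanSpace k).trans
      (congrArg Real.sqrt (hev hT _ _))
  let U : Matrix n n ℝ := (hA.eigenvectorUnitary : Matrix n n ℝ)
  have hUU : Uᴴ * U = 1 := Unitary.coe_star_mul_self hA.eigenvectorUnitary
  refine ⟨U * diagonal (fun i => √(hA.eigenvalues i)) * Uᴴ, ?_, ?_, ?_⟩
  · exact (PosSemidef.diagonal fun i => Real.sqrt_nonneg _).mul_mul_conjTranspose_same U
  · have h := hA.spectral_theorem
    rw [Unitary.conjStarAlgAut_apply] at h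
    calc _ = U * (diagonal (fun i => √(hA.eigenvalues i)) * (Uᴴ * U)
            * diagonal (fun i => √(hA.eigenvalues i))) * Uᴴ := by simp only [Matrix.mul_assoc]
      _ = U * diagonal hA.eigenvalues * Uᴴ := by
          rw [hUU, Matrix.mul_one, diagonal_mul_diagonal]
          simp only [Real.mul_self_sqrt (hpos.eigenvalues_nonneg _)]
      _ = Aᴴ * A := h.symm
      _ = Aᵀ * A := by rw [conjTranspose_eq_transpose_of_trivial]
  · rw [Matrix.mul_assoc, trace_mul_comm, Matrix.mul_assoc, hUU, Matrix.mul_one, trace_diagonal,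
      traceNorm, Finset.sum_range]
    simp only [hsv, IsHermitian.eigenvalues]
    exact Equiv.sum_comp _ fun k => √(hA.eigenvalues₀ k)

theorem frobenius_norm_sq_eq_trace (K : Matrix n n ℝ) : ‖K‖ ^ 2 = (Kᵀ * K).trace := by
  rw [frobenius_norm_def, ← Real.sqrt_eq_rpow, Real.sq_sqrt (by positivity), Finset.sum_comm]
  simp [trace, mul_apply, sq]

theorem exists_abs_trace_le (n : Type*) [Fintype n] [DecidableEq n] :
    ∃ C : ℝ, 0 ≤ C ∧ ∀ M : Matrix n n ℝ, |M.trace| ≤ C * ‖M‖ :=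
  let ⟨C, hC, h⟩ := (LinearMap.toContinuousLinearMap (traceLinearMap n ℝ ℝ)).isBoundedLinearMap.bound
  ⟨C, hC.le, h⟩

/-- Stability of square roots near a positive diagonal matrix, measured by the trace. -/
theorem abs_trace_sub_le {C μ : ℝ} (hC : 0 ≤ C)
    (hCM : ∀ M : Matrix n n ℝ, |M.trace| ≤ C * ‖M‖) (hμ : 0 < μ) {d : n → ℝ} (hd : ∀ i, μ ≤ d i)
    {X Y : Matrix n n ℝ} (hX : X.IsSymm) (hY : Y.PosSemidef)
    (hXd : C * ‖X - diagonal d‖ ≤ μ / 2) :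
    |(Y - X).trace| ≤ 2 * C ^ 2 / μ * ‖Y * Y - X * X‖ := by
  have hYs : Yᵀ = Y := by simpa using hY.isHermitian.eq
  obtain ⟨K, hK⟩ : ∃ K, K = Y - X := ⟨_, rfl⟩
  have hKs : Kᵀ = K := by rw [hK, transpose_sub, hYs, hX.eq]
  have h1 : 0 ≤ (K * Y * K).trace := by
    have := (hY.conjTranspose_mul_mul_same K).trace_nonneg
    rwa [conjTranspose_eq_transpose_of_trivial, hKs] at this
  have hKn : ‖K‖ ^ 2 = (K * K).trace := by rw [frobenius_norm_sq_eq_trace, hKs]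
  have h2 : μ * ‖K‖ ^ 2 ≤ (K * K * diagonal d).trace := by
    rw [hKn, trace, trace, Finset.mul_sum]
    refine Finset.sum_le_sum fun i _ => ?_
    rw [diag_apply, diag_apply, mul_diagonal, mul_comm]
    refine mul_le_mul_of_nonneg_left (hd i) ?_
    nth_rewrite 1 [← hKs]
    rw [mul_apply]
    exact Finset.sum_nonneg fun j _ => mul_self_nonneg _
  have h3 : |(K * K * (X - diagonal d)).trace| ≤ μ / 2 * ‖K‖ ^ 2 := by
    refine (hCM _).trans ?_
    have := (frobenius_norm_mul (K * K) (X - diagonal d)).trans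
      (mul_le_mul_of_nonneg_right (frobenius_norm_mul K K) (norm_nonneg _))
    calc _ ≤ C * (‖K‖ * ‖K‖ * ‖X - diagonal d‖) := mul_le_mul_of_nonneg_left this hC
      _ = C * ‖X - diagonal d‖ * ‖K‖ ^ 2 := by ring
      _ ≤ _ := mul_le_mul_of_nonneg_right hXd (sq_nonneg _)
  -- From `Y² - X² = Y K + K X`: pairing with `K` leaves a nonnegative term and one at least `μ / 2
  -- * ‖K‖²`.
  have h4 : (K * (Y * Y - X * X)).trace
      = (K * Y * K).trace + (K * K * diagonal d).trace + (K * K * (X - diagonal d)).trace := by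
    rw [← trace_add, ← trace_add]
    congr 1
    simp only [hK]
    noncomm_ring
  have h5 : (K * (Y * Y - X * X)).trace ≤ C * (‖K‖ * ‖Y * Y - X * X‖) :=
    (le_abs_self _).trans <| (hCM _).trans <|
      mul_le_mul_of_nonneg_left (frobenius_norm_mul _ _) hC
  have h6 : μ / 2 * ‖K‖ ≤ C * ‖Y * Y - X * X‖ := by
    rcases (norm_nonneg K).eq_or_lt with h0 | h0
    · rw [← h0, mul_zero]; positivity
    · refine le_of_mul_le_mul_right ?_ h0
      linarith [neg_abs_le (K * K * (X - diagonal d)).trace]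
  rw [← hK]
  calc |K.trace| ≤ C * ‖K‖ := hCM K
    _ = 2 * C / μ * (μ / 2 * ‖K‖) := by field_simp
    _ ≤ 2 * C / μ * (C * ‖Y * Y - X * X‖) := mul_le_mul_of_nonneg_left h6 (by positivity)
    _ = _ := by ring

end Sqrt

/-! ### Sylvester equations and the approximate root. -/

section Sylvester

variable {n : Type*}

/-- The solution `X` of the Sylvester equation `diag(d) X + X diag(d) = M`. -/
noncomputable def sylvesterSol (d : n → ℝ) : Matrix n n ℝ →ₗ[ℝ] Matrix n n ℝ where
  toFun M := of fun i j => M i j / (d i + d j)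
  map_add' M N := by ext i j; simp [add_div]
  map_smul' c M := by ext i j; simp [mul_div_assoc]

@[simp] theorem sylvesterSol_apply (d : n → ℝ) (M : Matrix n n ℝ) (i j : n) :
    sylvesterSol d M i j = M i j / (d i + d j) := rfl

theorem isSymm_sylvesterSol (d : n → ℝ) {M : Matrix n n ℝ} (hM : M.IsSymm) :
    (sylvesterSol d M).IsSymm := by
  ext i j
  simp [hM.apply, add_comm]

variable [Fintype n] [DecidableEq n]

theorem diagonal_mul_sylvesterSol_add {d : n → ℝ} (hd : ∀ i, 0 < d i) (M : Matrix n n ℝ) :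
    diagonal d * sylvesterSol d M + sylvesterSol d M * diagonal d = M := by
  ext i j
  have := (add_pos (hd i) (hd j)).ne'
  simp only [Matrix.add_apply, diagonal_mul, mul_diagonal, sylvesterSol_apply]
  field_simp

/-- First-order term of the square root of `diag(d)² + 2 D Δ D + D Δ² D`, for `D = diag(a)`. -/
noncomputable def sqrtFst (d a : n → ℝ) (Δ : Matrix n n ℝ) : Matrix n n ℝ :=
  sylvesterSol d ((2 : ℝ) • (diagonal a * Δ * diagonal a))

/-- Second-order term of the square root of `diag(d)² + 2 D Δ D + D Δ² D`, for `D = diag(a)`. -/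
noncomputable def sqrtSnd (d a : n → ℝ) (Δ : Matrix n n ℝ) : Matrix n n ℝ :=
  sylvesterSol d (diagonal a * (Δ * Δ) * diagonal a - sqrtFst d a Δ * sqrtFst d a Δ)

theorem isSymm_sqrtFst (d a : n → ℝ) {Δ : Matrix n n ℝ} (h : Δ.IsSymm) :
    (sqrtFst d a Δ).IsSymm := by
  refine isSymm_sylvesterSol d ?_
  rw [IsSymm, transpose_smul]
  simp only [transpose_mul, diagonal_transpose, h.eq, Matrix.mul_assoc]

theorem isSymm_sqrtSnd (d a : n → ℝ) {Δ : Matrix n n ℝ} (h : Δ.IsSymm) :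
    (sqrtSnd d a Δ).IsSymm := by
  refine isSymm_sylvesterSol d ?_
  rw [IsSymm, transpose_sub]
  simp only [transpose_mul, diagonal_transpose, h.eq, (isSymm_sqrtFst d a h).eq, Matrix.mul_assoc]

/-- The two Sylvester equations match the terms of orders one and two; the last bracket has order at
least three. -/
theorem sqrt_approx_mul_self {d : n → ℝ} (hd : ∀ i, 0 < d i) (a : n → ℝ) (Δ : Matrix n n ℝ) :
    (diagonal d + sqrtFst d a Δ + sqrtSnd d a Δ) * (diagonal d + sqrtFst d a Δ + sqrtSnd d a Δ)
      = diagonal d * diagonal d + (2 : ℝ) • (diagonal a * Δ * diagonal a)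
        + diagonal a * (Δ * Δ) * diagonal a
        + (sqrtFst d a Δ * sqrtSnd d a Δ + sqrtSnd d a Δ * sqrtFst d a Δ
          + sqrtSnd d a Δ * sqrtSnd d a Δ) := by
  have h1 : diagonal d * sqrtFst d a Δ + sqrtFst d a Δ * diagonal d
      = (2 : ℝ) • (diagonal a * Δ * diagonal a) := diagonal_mul_sylvesterSol_add hd _
  have h2 : diagonal d * sqrtSnd d a Δ + sqrtSnd d a Δ * diagonal d
      = diagonal a * (Δ * Δ) * diagonal a - sqrtFst d a Δ * sqrtFst d a Δ :=
    diagonal_mul_sylvesterSol_add hd _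
  have h3 := sub_eq_iff_eq_add.1 h2.symm
  rw [← h1, h3]
  noncomm_ring

theorem sqrtFst_isBigO (d a : n → ℝ) (l : Filter (Matrix n n ℝ)) :
    sqrtFst d a =O[l] fun Δ => Δ := by
  let T : Matrix n n ℝ →ₗ[ℝ] Matrix n n ℝ := sylvesterSol d ∘ₗ
    ((2 : ℝ) • (LinearMap.mulRight ℝ (diagonal a) ∘ₗ LinearMap.mulLeft ℝ (diagonal a)))
  exact (LinearMap.toContinuousLinearMap T).isBigO_id l

theorem sqrtSnd_isBigO (d a : n → ℝ) (l : Filter (Matrix n n ℝ)) :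
    sqrtSnd d a =O[l] fun Δ => ‖Δ‖ ^ 2 := by
  have h1 : (fun Δ : Matrix n n ℝ => diagonal a * (Δ * Δ) * diagonal a) =O[l] fun Δ => ‖Δ‖ ^ 2 := by
    let T : Matrix n n ℝ →ₗ[ℝ] Matrix n n ℝ :=
      LinearMap.mulRight ℝ (diagonal a) ∘ₗ LinearMap.mulLeft ℝ (diagonal a)
    refine ((LinearMap.toContinuousLinearMap T).isBigO_comp (fun Δ => Δ * Δ) l).trans ?_
    exact .of_norm_le fun Δ => by simpa [sq] using frobenius_norm_mul Δ Δ
  have h2 : (fun Δ : Matrix n n ℝ => sqrtFst d a Δ * sqrtFst d a Δ) =O[l] fun Δ => ‖Δ‖ ^ 2 := by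
    have h := (sqrtFst_isBigO d a l).norm_right
    simpa only [sq] using h.mul h
  exact ((LinearMap.toContinuousLinearMap (sylvesterSol d)).isBigO_comp _ l).trans (h1.sub h2)

end Sylvester

/-! ### Removing signs and the kernel. -/

/-- The square root of the Gram matrix, completed to an invertible matrix on the zero set of `w`
and with the signs of `w` removed. -/
theorem exists_posSemidef_sq_eq {n : Type*} [Fintype n] [DecidableEq n] (w : n → ℝ)
    {Δ : Matrix n n ℝ} (hΔ : Δ.IsSymm) :
    ∃ Y : Matrix n n ℝ, Y.PosSemidef ∧
      Y * Y = diagonal (fun i => |w i| + if w i = 0 then 1 else 0)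
          * diagonal (fun i => |w i| + if w i = 0 then 1 else 0)
        + (2 : ℝ) • (diagonal (fun i => |w i|) * Δ * diagonal (fun i => |w i|))
        + diagonal (fun i => |w i|) * (Δ * Δ) * diagonal (fun i => |w i|) ∧
      Y.trace = traceNorm ((1 + Δ) * diagonal w) + ∑ i, if w i = 0 then 1 else 0 := by
  obtain ⟨Y, hY, hYY, htr⟩ := exists_posSemidef_sq_eq_transpose_mul_self ((1 + Δ) * diagonal w)
  -- The sign is `1` at zeros of `w`, so that `S` is an involution fixing `Z`.
  let S : Matrix n n ℝ := diagonal fun i => if w i < 0 then -1 else 1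
  let Z : Matrix n n ℝ := diagonal fun i => if w i = 0 then 1 else 0
  let D : Matrix n n ℝ := diagonal fun i => |w i|
  have hSS : S * S = 1 := by
    rw [diagonal_mul_diagonal, ← diagonal_one]
    congr 1; ext i; split_ifs <;> norm_num
  have hSZ : S * Z = Z := by
    rw [diagonal_mul_diagonal]
    congr 1; ext i; split_ifs <;> linarith
  have hZS : Z * S = Z := by
    rw [← (commute_diagonal _ _ : Commute S Z).eq, hSZ]
  have hWS : diagonal w * S = D := by
    rw [diagonal_mul_diagonal]
    congr 1; ext i; split_ifs with h
    · rw [abs_of_neg h]; ring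
    · rw [abs_of_nonneg (not_lt.1 h), mul_one]
  have hSW : S * diagonal w = D := by
    rw [← hWS, diagonal_mul_diagonal, diagonal_mul_diagonal]; simp only [mul_comm]
  have hWZ : diagonal w * Z = 0 := by
    rw [diagonal_mul_diagonal, ← diagonal_zero]
    congr 1; ext i; split_ifs with h <;> simp [h]
  have hYs : Yᴴ = Y := hY.isHermitian.eq
  have hZs : Zᴴ = Z := by
    rw [conjTranspose_eq_transpose_of_trivial, diagonal_transpose]
  have hSs : Sᴴ = S := by
    rw [conjTranspose_eq_transpose_of_trivial, diagonal_transpose]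
  -- `(Y Z)ᴴ (Y Z) = Z Y² Z`, and `Y²` ends in `diagonal w`, which kills `Z`. Hence the cross terms
  -- vanish when `S Y S + Z` is squared.
  have hYZ : Y * Z = 0 := by
    rw [← conjTranspose_mul_self_eq_zero, conjTranspose_mul, hYs, hZs, Matrix.mul_assoc,
      ← Matrix.mul_assoc Y, hYY, Matrix.mul_assoc _ _ Z, Matrix.mul_assoc _ _ Z, hWZ]
    simp
  have hZY : Z * Y = 0 := by
    have := congrArg conjTranspose hYZ
    rwa [conjTranspose_mul, hYs, hZs, conjTranspose_zero] at this
  refine ⟨S * Y * S + Z, ?_, ?_, ?_⟩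
  · refine PosSemidef.add ?_ (PosSemidef.diagonal fun i => ?_)
    · have := hY.mul_mul_conjTranspose_same S
      rwa [hSs] at this
    · dsimp; split_ifs <;> norm_num
  · have hDZ : D * Z = 0 := by rw [← hSW, Matrix.mul_assoc, hWZ, Matrix.mul_zero]
    have hZD : Z * D = 0 := by
      rw [← hDZ, diagonal_mul_diagonal, diagonal_mul_diagonal]; simp only [mul_comm]
    have hd : diagonal (fun i => |w i| + if w i = 0 then (1 : ℝ) else 0) = D + Z := by
      rw [diagonal_add]
    have e1 : S * (Y * Y) * S = D * ((1 + Δ) * (1 + Δ)) * D := by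
      rw [hYY, transpose_mul, diagonal_transpose, transpose_add, transpose_one, hΔ.eq]
      calc _ = S * diagonal w * ((1 + Δ) * (1 + Δ)) * (diagonal w * S) := by
            simp only [Matrix.mul_assoc]
        _ = _ := by rw [hSW, hWS]
    have e2 : (S * Y * S + Z) * (S * Y * S + Z) = S * (Y * Y) * S + Z * Z := by
      calc _ = S * Y * (S * S) * Y * S + S * (Y * (S * Z)) + Z * S * Y * S + Z * Z := by
            noncomm_ring
        _ = _ := by
            rw [hSS, hSZ, hYZ, hZS, hZY]
            noncomm_ring
    rw [e2, e1, hd]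
    calc _ = D * D + D * Z + Z * D + Z * Z + (D * Δ * D + D * Δ * D) + D * (Δ * Δ) * D := by
          rw [hDZ, hZD]; noncomm_ring
      _ = _ := by rw [two_smul]; noncomm_ring
  · rw [trace_add, trace_mul_comm, ← Matrix.mul_assoc, hSS, Matrix.one_mul, htr, trace_diagonal]

/-! ### Traces of the corrections. -/

theorem sum_sum_congr_of_symm {n : Type*} [Fintype n] {F G : n → n → ℝ}
    (h : ∀ i j, F i j + F j i = G i j + G j i) : ∑ i, ∑ j, F i j = ∑ i, ∑ j, G i j := by
  have hF : ∑ i, ∑ j, F j i = ∑ i, ∑ j, F i j := Finset.sum_comm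
  have hG : ∑ i, ∑ j, G j i = ∑ i, ∑ j, G i j := Finset.sum_comm
  have : ∑ i, ∑ j, (F i j + F j i) = ∑ i, ∑ j, (G i j + G j i) := by simp only [h]
  simp only [Finset.sum_add_distrib, hF, hG] at this
  linarith

theorem trace_sqrtFst {n : Type*} [Fintype n] [DecidableEq n] (w : n → ℝ) (Δ : Matrix n n ℝ) :
    (sqrtFst (fun i => |w i| + if w i = 0 then 1 else 0) (fun i => |w i|) Δ).trace
      = ∑ i, Δ i i * |w i| := by
  refine Finset.sum_congr rfl fun i _ => ?_
  simp only [sqrtFst, diag_apply, sylvesterSol_apply, Matrix.smul_apply, mul_diagonal, diagonal_mul,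
    smul_eq_mul]
  split_ifs with h
  · simp [h]
  · have := abs_pos.2 h
    field_simp
    ring

/-- The diagonal entries give a double sum that is not symmetric in `i, j`: rows with `w i = 0`
vanish. The summands agree with the penalties only after adding the `(i, j)` and `(j, i)` terms. -/
theorem trace_sqrtSnd {n : Type*} [Fintype n] [DecidableEq n] (w : n → ℝ) {Δ : Matrix n n ℝ}
    (hΔ : Δ.IsSymm) :
    (sqrtSnd (fun i => |w i| + if w i = 0 then 1 else 0) (fun i => |w i|) Δ).trace
      = ∑ i, ∑ j, pairPenalty (Δ i j) |w i| |w j| := by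
  have h0 : (sqrtSnd (fun i => |w i| + if w i = 0 then 1 else 0) (fun i => |w i|) Δ).trace
      = ∑ i, ∑ j, (if w i = 0 then 0 else
          if w j = 0 then Δ i j ^ 2 * |w i| / 2 else
            Δ i j ^ 2 * (|w i| / 2 - 2 * |w i| * |w j| ^ 2 / (|w i| + |w j|) ^ 2)) := by
    refine Finset.sum_congr rfl fun i _ => ?_
    simp only [sqrtSnd, sqrtFst, diag_apply, sylvesterSol_apply, Matrix.sub_apply, Matrix.smul_apply,
      mul_diagonal, diagonal_mul, mul_apply (M := sylvesterSol _ _), mul_apply (M := Δ), smul_eq_mul,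
      Finset.mul_sum, Finset.sum_mul, ← Finset.sum_sub_distrib, Finset.sum_div]
    refine Finset.sum_congr rfl fun j _ => ?_
    rw [hΔ.apply i j]
    by_cases hi : w i = 0
    · simp [hi]
    · have hi' := abs_pos.2 hi
      by_cases hj : w j = 0
      · simp only [hi, hj, if_true, if_false, abs_zero]
        field_simp
        ring
      · have hj' := abs_pos.2 hj
        simp only [hi, hj, if_false, add_zero]
        field_simp
        ring
  rw [h0]
  refine sum_sum_congr_of_symm fun i j => ?_
  rw [hΔ.apply i j, pairPenalty, pairPenalty]
  simp only [abs_eq_zero]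
  by_cases hi : w i = 0 <;> by_cases hj : w j = 0
  · simp [hi, hj]
  · have hj' := abs_pos.2 hj
    simp only [hi, hj, if_true, if_false, abs_zero, and_false, false_and]
    field_simp
    ring
  · have hi' := abs_pos.2 hi
    simp only [hi, hj, if_true, if_false, abs_zero, and_false, false_and]
    field_simp
    ring
  · have hi' := abs_pos.2 hi
    have hj' := abs_pos.2 hj
    simp only [hi, hj, if_false, and_false]
    field_simp
    ring

/-! ### The expansion and its two forms. -/

theorem exists_pos_le {n : Type*} [Finite n] {d : n → ℝ} (hd : ∀ i, 0 < d i) :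
    ∃ μ > 0, ∀ i, μ ≤ d i := by
  cases isEmpty_or_nonempty n
  · exact ⟨1, one_pos, fun i => isEmptyElim i⟩
  · obtain ⟨i, hi⟩ := Finite.exists_min d
    exact ⟨d i, hd i, hi⟩

theorem traceNorm_expansion {n : Type*} [Fintype n] [DecidableEq n] (w : n → ℝ) :
    (fun Δ : Matrix n n ℝ => traceNorm ((1 + Δ) * diagonal w)
        - ((∑ i, |w i|) + (∑ i, Δ i i * |w i|) + ∑ i, ∑ j, pairPenalty (Δ i j) |w i| |w j|))
      =o[𝓝[{Δ | Δ.IsSymm}] 0] fun Δ => ‖Δ‖ ^ 2 := by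
  obtain ⟨C, hC, hCM⟩ := exists_abs_trace_le n
  let a : n → ℝ := fun i => |w i|
  let d : n → ℝ := fun i => |w i| + if w i = 0 then 1 else 0
  have hd0 : ∀ i, 0 < d i := fun i => by
    by_cases h : w i = 0 <;> simp [d, h]
  obtain ⟨μ, hμ, hd⟩ := exists_pos_le hd0
  let l : Filter (Matrix n n ℝ) := 𝓝[{Δ | Δ.IsSymm}] 0
  have hl : Tendsto (fun Δ : Matrix n n ℝ => Δ) l (𝓝 0) := 
    tendsto_nhdsWithin_of_tendsto_nhds tendsto_id
  have hln : Tendsto (fun Δ : Matrix n n ℝ => ‖Δ‖) l (𝓝 0) := by simpa using hl.norm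
  have h1 := (sqrtFst_isBigO d a l).norm_right
  have h2 := sqrtSnd_isBigO d a l
  have h12 : (fun Δ : Matrix n n ℝ => ‖Δ‖ * ‖Δ‖ ^ 2) =o[l] fun Δ => ‖Δ‖ ^ 2 := by
    simpa using ((isLittleO_one_iff ℝ).2 hln).mul_isBigO (isBigO_refl (fun Δ => ‖Δ‖ ^ 2) l)
  have h2o : sqrtSnd d a =o[l] fun _ => (1 : ℝ) :=
    h2.trans_isLittleO ((isLittleO_one_iff ℝ).2 (by simpa using hln.pow 2))
  have hR : (fun Δ => sqrtFst d a Δ * sqrtSnd d a Δ + sqrtSnd d a Δ * sqrtFst d a Δ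
      + sqrtSnd d a Δ * sqrtSnd d a Δ) =o[l] fun Δ => ‖Δ‖ ^ 2 := by
    refine IsLittleO.add (IsLittleO.add ?_ ?_) ?_
    · exact (h1.mul h2).trans_isLittleO h12
    · refine (h2.mul h1).trans_isLittleO ?_
      simpa only [mul_comm] using h12
    · simpa using h2o.mul_isBigO h2
  have hX : Tendsto (fun Δ => C * ‖sqrtFst d a Δ + sqrtSnd d a Δ‖) l (𝓝 0) := by
    have t1 : Tendsto (sqrtFst d a) l (𝓝 0) := h1.trans_tendsto hln
    have t2 : Tendsto (sqrtSnd d a) l (𝓝 0) := (isLittleO_one_iff ℝ).1 h2o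
    simpa using ((t1.add t2).norm).const_mul C
  refine IsBigO.trans_isLittleO (IsBigO.of_bound (2 * C ^ 2 / μ) ?_) hR
  filter_upwards [self_mem_nhdsWithin, hX.eventually_le_const (half_pos hμ)] with Δ hΔ hsmall
  have hΔ : Δ.IsSymm := hΔ
  obtain ⟨Y, hY, hYY, htr⟩ := exists_posSemidef_sq_eq w hΔ
  have hXs : (diagonal d + sqrtFst d a Δ + sqrtSnd d a Δ).IsSymm :=
    ((isSymm_diagonal d).add (isSymm_sqrtFst d a hΔ)).add (isSymm_sqrtSnd d a hΔ)
  have key := abs_trace_sub_le hC hCM hμ hd hXs hY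
    (by rwa [add_assoc, add_sub_cancel_left])
  -- The number of zeros of `w` enters both `Y.trace` and the trace of `diagonal d`, and cancels.
  rw [sqrt_approx_mul_self hd0, hYY, sub_add_cancel_left, norm_neg, trace_sub, trace_add, trace_add,
    trace_sqrtFst, trace_sqrtSnd w hΔ, htr, trace_diagonal, Finset.sum_add_distrib] at key
  rw [Real.norm_eq_abs]
  convert key using 2
  ring

/-- A pair with exactly one zero coefficient occurs once on the left, with weight `1 / 2`, and twice
on the right, with weight `1 / 4`. -/
theorem sum_pos_pos_add_sum_zero_pos {n : Type*} [Fintype n] (w : n → ℝ) {Δ : Matrix n n ℝ}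
    (hΔ : Δ.IsSymm) :
    (∑ i with 0 < |w i|, ∑ j with 0 < |w j|,
        (Δ j i * |w i| - Δ i j * |w j|) ^ 2 / (4 * (|w i| + |w j|)))
      + (∑ i with |w i| = 0, ∑ j with 0 < |w j|, (Δ i j * |w j|) ^ 2 / (2 * |w j|))
      = ∑ i, ∑ j, pairPenalty (Δ i j) |w i| |w j| := by
  simp only [Finset.sum_filter, ← Finset.sum_add_distrib, abs_pos,
    abs_eq_zero]
  have : ∀ i, ((if w i ≠ 0 then ∑ j, if w j ≠ 0 then
          (Δ j i * |w i| - Δ i j * |w j|) ^ 2 / (4 * (|w i| + |w j|)) else 0 else 0)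
        + if w i = 0 then ∑ j, if w j ≠ 0 then (Δ i j * |w j|) ^ 2 / (2 * |w j|) else 0 else 0)
      = ∑ j, if w j = 0 then 0 else if w i = 0 then Δ i j ^ 2 * |w j| / 2 else
          (Δ j i * |w i| - Δ i j * |w j|) ^ 2 / (4 * (|w i| + |w j|)) := fun i => by
    by_cases hi : w i = 0
    · simp only [hi, ne_eq, not_true_eq_false, if_false, if_true, zero_add]
      refine Finset.sum_congr rfl fun j _ => ?_
      by_cases hj : w j = 0
      · simp [hj]
      · have := abs_pos.2 hj
        simp only [hj, not_false_eq_true, if_true, if_false]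
        field_simp
    · simp [hi]
  rw [Finset.sum_congr rfl fun i _ => this i]
  refine sum_sum_congr_of_symm fun i j => ?_
  rw [hΔ.apply i j, pairPenalty, pairPenalty]
  simp only [abs_eq_zero]
  by_cases hi : w i = 0 <;> by_cases hj : w j = 0
  · simp [hi, hj]
  · have hj' := abs_pos.2 hj
    simp only [hi, hj, if_true, if_false, abs_zero, and_false, false_and]
    field_simp
    ring
  · have hi' := abs_pos.2 hi
    simp only [hi, hj, if_true, if_false, abs_zero, and_false, false_and]
    field_simp
    ring
  · have hi' := abs_pos.2 hi
    have hj' := abs_pos.2 hj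
    simp only [hi, hj, if_false, and_false]
    field_simp

/-! ### Shrinkage. -/

theorem pairPenalty_comm (d a b : ℝ) : pairPenalty d a b = pairPenalty d b a := by
  unfold pairPenalty
  simp only [and_comm (a := b = 0), add_comm b a, ← neg_sub a b, neg_sq]

theorem pairPenalty_nonneg {a b : ℝ} (d : ℝ) (ha : 0 ≤ a) (hb : 0 ≤ b) :
    0 ≤ pairPenalty d a b := by
  unfold pairPenalty
  split_ifs <;> positivity

theorem pairPenalty_eq_zero_iff {d a b : ℝ} (hd : d ≠ 0) (ha : 0 ≤ a) (hb : 0 ≤ b) :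
    pairPenalty d a b = 0 ↔ a = b := by
  unfold pairPenalty
  split_ifs with h
  · simp [h.1, h.2]
  · have : a + b ≠ 0 := fun h' => h ⟨by linarith, by linarith⟩
    simp [hd, this, sub_eq_zero]

theorem pairPenalty_lt_of_le {d x y a b : ℝ} (hd : d ≠ 0) (hx : 0 ≤ x) (hxa : x ≤ a) (hab : a ≤ b)
    (hby : b ≤ y) (h : b - a < y - x) : pairPenalty d a b < pairPenalty d x y := by
  have hxy : x < y := by linarith
  have hpos : 0 < pairPenalty d x y :=
    (pairPenalty_nonneg d hx (by linarith)).lt_of_ne' fun h0 =>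
      hxy.ne ((pairPenalty_eq_zero_iff hd hx (by linarith)).1 h0)
  rcases hab.eq_or_lt with rfl | hab
  · rwa [(pairPenalty_eq_zero_iff hd (hx.trans hxa) (hx.trans hxa)).2 rfl]
  · have h1 : ¬ (a = 0 ∧ b = 0) := fun h' => by linarith [h'.1, h'.2]
    have h2 : ¬ (x = 0 ∧ y = 0) := fun h' => by linarith [h'.1, h'.2]
    rw [pairPenalty, pairPenalty, if_neg h1, if_neg h2, mul_div_assoc, mul_div_assoc]
    refine mul_lt_mul_of_pos_left ?_ (by positivity)
    have hs : 0 < a + b := by linarith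
    have ht : 0 < x + y := by linarith
    rw [div_lt_div_iff₀ (by positivity) (by positivity)]
    -- The relative gap does not grow, since this amounts to `b * x ≤ a * y`; multiplying by the
    -- strict bound on the gap itself gives the claim.
    have k1 : (b - a) * (x + y) ≤ (y - x) * (a + b) := by nlinarith
    have k2 : (b - a) * ((b - a) * (x + y)) < (y - x) * ((y - x) * (a + b)) :=
      mul_lt_mul h k1 (by nlinarith) (by linarith)
    nlinarith

theorem pairPenalty_lt {d x y a b : ℝ} (hd : d ≠ 0) (hx : 0 ≤ x) (hy : 0 ≤ y)
    (ha : a ∈ Set.uIcc x y) (hb : b ∈ Set.uIcc x y) (h : |a - b| < |x - y|) :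
    pairPenalty d a b < pairPenalty d x y := by
  wlog hxy : x ≤ y generalizing x y
  · rw [pairPenalty_comm d x y]
    exact this hy hx (by rwa [Set.uIcc_comm]) (by rwa [Set.uIcc_comm]) (by rwa [abs_sub_comm y x])
      (not_le.1 hxy).le
  wlog hab : a ≤ b generalizing a b
  · rw [pairPenalty_comm d a b]
    exact this hb ha (by rwa [abs_sub_comm b a]) (not_le.1 hab).le
  rw [Set.uIcc_of_le hxy] at ha hb
  rw [abs_sub_comm, abs_of_nonneg (sub_nonneg.2 hab), abs_sub_comm,
    abs_of_nonneg (sub_nonneg.2 hxy)] at h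
  exact pairPenalty_lt_of_le hd hx ha.1 hab hb.2 h

end TraceLasso

theorem mainTheorem3 (p : ℕ) (w : Fin p → ℝ) :
    -- second-order expansion, as the symmetric perturbation tends to zero
    ((fun Δ : Matrix (Fin p) (Fin p) ℝ =>
        TraceLasso.traceNorm ((1 + Δ) * Matrix.diagonal w)
          - ((∑ i, |w i|) + (∑ i, Δ i i * |w i|)
            + ((∑ i with 0 < |w i|, ∑ j with 0 < |w j|,
                  (Δ j i * |w i| - Δ i j * |w j|) ^ 2 / (4 * (|w i| + |w j|)))
              + ∑ i with |w i| = 0, ∑ j with 0 < |w j|, (Δ i j * |w j|) ^ 2 / (2 * |w j|))))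
      =o[𝓝[{Δ | Δ.IsSymm}] 0] fun Δ => ‖Δ‖ ^ 2) ∧
    -- the same expansion in its simplified form
    ((fun Δ : Matrix (Fin p) (Fin p) ℝ =>
        TraceLasso.traceNorm ((1 + Δ) * Matrix.diagonal w)
          - ((∑ i, |w i|) + (∑ i, Δ i i * |w i|)
            + ∑ i, ∑ j, TraceLasso.pairPenalty (Δ i j) |w i| |w j|))
      =o[𝓝[{Δ | Δ.IsSymm}] 0] fun Δ => ‖Δ‖ ^ 2) ∧
    -- shrinkage: the second-order term of a pair with nonzero correlation is nonnegative, vanishes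
    -- only for equal absolute values, and decreases when these move toward each other
    (∀ (Δ : Matrix (Fin p) (Fin p) ℝ) (i j : Fin p), Δ i j ≠ 0 →
      0 ≤ TraceLasso.pairPenalty (Δ i j) |w i| |w j| ∧
      (TraceLasso.pairPenalty (Δ i j) |w i| |w j| = 0 ↔ |w i| = |w j|) ∧
      ∀ a ∈ Set.uIcc |w i| |w j|, ∀ b ∈ Set.uIcc |w i| |w j|,
        |a - b| < |(|w i| - |w j|)| →
          TraceLasso.pairPenalty (Δ i j) a b < TraceLasso.pairPenalty (Δ i j) |w i| |w j|) := by
  have h := TraceLasso.traceNorm_expansion w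
  refine ⟨h.congr' ?_ EventuallyEq.rfl, h, fun Δ i j hd =>
    ⟨TraceLasso.pairPenalty_nonneg _ (abs_nonneg _) (abs_nonneg _),
      TraceLasso.pairPenalty_eq_zero_iff hd (abs_nonneg _) (abs_nonneg _), fun a ha b hb hab =>
      TraceLasso.pairPenalty_lt hd (abs_nonneg _) (abs_nonneg _) ha hb hab⟩⟩
  filter_upwards [self_mem_nhdsWithin] with Δ hΔ
  rw [TraceLasso.sum_pos_pos_add_sum_zero_pos w hΔ]
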